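/- Let $\Sigma$ be a finite alphabet with an independence relation $I\subseteq\Sigma\times\Sigma$, i.e. an irreflexive symmetric relation. Words $u,v\in\Sigma^*$ are independent, $u\,I\,v$, if $a\,I\,b$ for every letter $a$ of $u$ and every letter $b$ of $v$. Let $\sim^I$ be the least congruence on $\Sigma^*$ with $ab\sim^I ba$ whenever $a\,I\,b$, and for $L\subseteq\Sigma^*$ let $[L]^I=\{w\mid\exists z\in L.\ w\sim^I z\}$. A word $a_1\cdots a_n$ is connected if the graph on the positions $1,\dots,n$ in which $i<j$ are joined when $a_i\,I\,a_j$ fails is connected (the empty word counts as connected); a language is connected if all its words are. Regular expressions are generated by $a\in\Sigma$, $0$, $1$, $E+F$, $EF$, $E^*$, and $[\![E]\!]$ is the language of $E$. The star-connected expressions are defined inductively: $0$, $1$ and $a\in\Sigma$ are star-connected; if $E,F$ are star-connected, so are $E+F$ and $EF$; if $E$ is star-connected and $[\![E]\!]$ is connected, then $E^*$ is star-connected. For $N\in\mathbb N$ and words $u,v,z$, write $u\mathrel{{\sim}{\lhd}}_N z\mathrel{{\rhd}{\sim}}v$ if there are $n\le N$, nonempty words $u_1,\dots,u_n$ and words $v_0,\dots,v_n$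 with $v_1,\dots,v_{n-1}$ nonempty, such that $z=v_0u_1v_1\cdots u_nv_n$, $v_j\,I\,u_i$ for all $j<i$, $u\sim^I u_1\cdots u_n$ and $v\sim^I v_0\cdots v_n$. A language $L$ has uniform ($I$-scattering) rank at most $N$ if $$\forall w\in[L]^I.\ \exists z\in L.\ \forall u,v.\ w=uv\Longrightarrow u\mathrel{{\sim}{\lhd}}_N z\mathrel{{\rhd}{\sim}}v,$$ and $L$ has uniform rank if this holds for some $N\in\mathbb N$. Proposition. 1. If $E$ is star-connected, then $[\![E]\!]$ has uniform rank. 2. For every regular expression $E$ and every $N\in\mathbb N$: if $[\![E]\!]$ is connected and has uniform rank at most $N$, then $[\![E^*]\!]$ has uniform rank at most $|\Sigma|\,(N+1)$. -/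

import Mathlib

/-- An independence relation on an alphabet: irreflexive and symmetric.
Dependence is its complement. -/
structure IsIndependence {α : Type*} (I : α → α → Prop) : Prop where
  irrefl : ∀ a, ¬ I a a
  symm : ∀ a b, I a b → I b a

/-- Independence of words: every letter of `u` is independent of every letter of `v`. -/
def WordIndep {α : Type*} (I : α → α → Prop) (u v : List α) : Prop :=
  ∀ a ∈ u, ∀ b ∈ v, I a b

/-- Trace equivalence: the least congruence on the free monoid of words with `ab ~ ba` for
independent letters `a`, `b`. -/
inductive TraceEquiv {α : Type*} (I : α → α → Prop) : List α → List α → Prop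
  | swap (a b : α) (h : I a b) : TraceEquiv I [a, b] [b, a]
  | refl (u : List α) : TraceEquiv I u u
  | symm {u v : List α} (h : TraceEquiv I u v) : TraceEquiv I v u
  | trans {u v w : List α} (h₁ : TraceEquiv I u v) (h₂ : TraceEquiv I v w) : TraceEquiv I u w
  | append {u u' v v' : List α} (h₁ : TraceEquiv I u u') (h₂ : TraceEquiv I v v') :
      TraceEquiv I (u ++ v) (u' ++ v')

/-- The trace closure of a word language. -/
def traceClosure {α : Type*} (I : α → α → Prop) (L : Language α) : Language α :=
  {w | ∃ z ∈ L, TraceEquiv I w z}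

/-- The dependence graph of a word, with directions of edges forgotten: the vertices are the
positions, and there is an edge between `i < j` if the letters at `i` and `j` are dependent. -/
def dependenceGraph {α : Type*} (I : α → α → Prop) (w : List α) : SimpleGraph (Fin w.length) :=
  SimpleGraph.fromRel fun i j => i < j ∧ ¬ I (w.get i) (w.get j)

/-- A word is connected if any two positions are joined by a path in its dependence graph
(in particular, the empty word is connected). -/
def WordConnected {α : Type*} (I : α → α → Prop) (w : List α) : Prop :=
  (dependenceGraph I w).Preconnected

/-- A language is connected if all its words are. -/
def LangConnected {α : Type*} (I : α → α → Prop) (L : Language α) : Prop :=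
  ∀ w ∈ L, WordConnected I w

/-- Star-connected regular expressions. -/
inductive StarConnected {α : Type*} (I : α → α → Prop) : RegularExpression α → Prop
  | zero : StarConnected I 0
  | one : StarConnected I 1
  | char (a : α) : StarConnected I (RegularExpression.char a)
  | add {E F : RegularExpression α} (hE : StarConnected I E) (hF : StarConnected I F) :
      StarConnected I (E + F)
  | mul {E F : RegularExpression α} (hE : StarConnected I E) (hF : StarConnected I F) :
      StarConnected I (E * F)
  | star {E : RegularExpression α} (hE : StarConnected I E)
      (hc : LangConnected I E.matches') : StarConnected I E.star

/-- `u₁, …, uₙ ◁ z ▷ v₀, …, vₙ`: the word `z` is `v₀ u₁ v₁ … uₙ vₙ`, the words `u₁, …, uₙ` and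
`v₁, …, vₙ₋₁` are nonempty, and `vⱼ` is independent of `uᵢ` for all `j < i`.
The word `uᵢ₊₁` of the mathematical notation is `u i` here. -/
structure IsScattering {α : Type*} (I : α → α → Prop) {n : ℕ} (u : Fin n → List α) (z : List α)
    (v : Fin (n + 1) → List α) : Prop where
  u_ne_nil : ∀ i, u i ≠ []
  v_ne_nil : ∀ j, j ≠ 0 → j ≠ Fin.last n → v j ≠ []
  eq : z = v 0 ++ (List.ofFn fun i : Fin n => u i ++ v i.succ).flatten
  indep : ∀ (i : Fin n) (j : Fin (n + 1)), j < i.succ → WordIndep I (v j) (u i)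

/-- `u ◁_N z ▷ v`: `uv` is scattered in `z` with degree at most `N`. -/
def ScatteredLE {α : Type*} (I : α → α → Prop) (N : ℕ) (u z v : List α) : Prop :=
  ∃ n ≤ N, ∃ (us : Fin n → List α) (vs : Fin (n + 1) → List α),
    u = (List.ofFn us).flatten ∧ v = (List.ofFn vs).flatten ∧ IsScattering I us z vs

/-- `u ∼◁_N z ▷∼ v`: degree-bounded scattering up to trace equivalence of `u` and of `v`. -/
def ScatteredEquivLE {α : Type*} (I : α → α → Prop) (N : ℕ) (u z v : List α) : Prop :=
  ∃ u' v', TraceEquiv I u u' ∧ ScatteredLE I N u' z v' ∧ TraceEquiv I v' v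

/-- `L` has uniform scattering rank at most `N`. -/
def HasUniformRankLE {α : Type*} (I : α → α → Prop) (L : Language α) (N : ℕ) : Prop :=
  ∀ w ∈ traceClosure I L, ∃ z ∈ L, ∀ u v, w = u ++ v → ScatteredEquivLE I N u z v

/-- `L` has (finite) uniform scattering rank. -/
def HasUniformRank {α : Type*} (I : α → α → Prop) (L : Language α) : Prop :=
  ∃ N, HasUniformRankLE I L N

/-!
A split `w = uv` of a word `w` that is trace equivalent to `z` is recorded by marking the letters of
`z` with `true` (those of `u`) or `false` (those of `v`). The degree of the scattering is the number
of maximal runs of `true`; see `scatteredEquivLE_iff`.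

If `w` is trace equivalent to `x₁ ⋯ xₘ`, the letters of `w` can be labelled by factors: the letters
with label `i` form a word equivalent to `xᵢ`, and letters whose labels are in the wrong order are
independent (`exists_isFactored`). A split of `w` splits every factor, and markings of
representatives of the factors combine to a marking of their product (`IsMarking.flatten`). For the
product of two languages the ranks therefore add up.

For the star, a factor may lie in `u`, lie in `v`, or be cut. A cut factor is connected, so it has
a letter `a` in `u` that depends on a letter `b` in `v`. Since `b` is independent of the part in `u`
of every later factor, the letter `a` does not occur there. Hence at most `|Σ|` factors are cut, and
they contribute at most `N` runs each. The factors are ordered by the lexicographically least word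
of labels (`exists_isFactored_no_inversion`), an order that does not depend on the split. Then
a factor in `v` is never directly followed by one in `u`, so each stretch between cut factors
contributes at most one further run. `rises_flatten_le` carries out the count and shows that at most
`|Σ|` stretches contribute.
-/

/-! ### Trace equivalence -/

theorem TraceEquiv.perm {α : Type*} {I : α → α → Prop} {u v : List α} (h : TraceEquiv I u v) :
    u.Perm v := by
  induction h with
  | swap a b h => exact List.Perm.swap _ _ _
  | refl u => exact List.Perm.refl _
  | symm _ ih => exact ih.symm
  | trans _ _ ih₁ ih₂ => exact ih₁.trans ih₂
  | append _ _ ih₁ ih₂ => exact ih₁.append ih₂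

theorem TraceEquiv.map {α β : Type*} {I : α → α → Prop} {J : β → β → Prop} (f : β → α)
    (hf : ∀ x y, J x y → I (f x) (f y)) {u v : List β} (h : TraceEquiv J u v) :
    TraceEquiv I (u.map f) (v.map f) := by
  induction h with
  | swap a b h => exact .swap _ _ (hf _ _ h)
  | refl u => exact .refl _
  | symm _ ih => exact ih.symm
  | trans _ _ ih₁ ih₂ => exact ih₁.trans ih₂
  | append _ _ ih₁ ih₂ => simpa using ih₁.append ih₂

theorem TraceEquiv.filter {α : Type*} {I : α → α → Prop} (p : α → Bool) {u v : List α}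
    (h : TraceEquiv I u v) : TraceEquiv I (u.filter p) (v.filter p) := by
  induction h with
  | swap a b h =>
    cases ha : p a <;> cases hb : p b <;> simp only [List.filter_cons, List.filter_nil, ha, hb] <;>
      first
        | exact .swap _ _ h
        | exact .refl _
  | refl u => exact .refl _
  | symm _ ih => exact ih.symm
  | trans _ _ ih₁ ih₂ => exact ih₁.trans ih₂
  | append _ _ ih₁ ih₂ => simpa using ih₁.append ih₂

/-- A relation that holds between independent letters in both orders does not see the swaps. -/
theorem TraceEquiv.pairwise_iff {α : Type*} {I R : α → α → Prop}
    (hR : ∀ x y, I x y → R x y ∧ R y x) {u v : List α} (h : TraceEquiv I u v) :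
    u.Pairwise R ↔ v.Pairwise R := by
  induction h with
  | swap a b h => simp [hR a b h]
  | refl u => exact Iff.rfl
  | symm _ ih => exact ih.symm
  | trans _ _ ih₁ ih₂ => exact ih₁.trans ih₂
  | append h₁ h₂ ih₁ ih₂ =>
    simp only [List.pairwise_append, ih₁, ih₂, h₁.perm.mem_iff, h₂.perm.mem_iff]

/-- Trace equivalence lifts along a labelling of letters: labels travel with their letters. -/
theorem TraceEquiv.lift {α β : Type*} {I : α → α → Prop} (f : β → α) {u v : List α}
    (h : TraceEquiv I u v) :
    (∀ V : List β, V.map f = v →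
      ∃ U : List β, U.map f = u ∧ TraceEquiv (fun x y => I (f x) (f y)) U V) ∧
    (∀ U : List β, U.map f = u →
      ∃ V : List β, V.map f = v ∧ TraceEquiv (fun x y => I (f x) (f y)) U V) := by
  induction h with
  | swap a b h =>
    constructor
    · intro V hV
      obtain ⟨x, V', rfl, rfl, hV'⟩ := List.map_eq_cons_iff.1 hV
      obtain ⟨y, V', rfl, rfl, hV''⟩ := List.map_eq_cons_iff.1 hV'
      obtain rfl := List.map_eq_nil_iff.1 hV''
      exact ⟨[y, x], rfl, .swap _ _ h⟩
    · intro V hV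
      obtain ⟨x, V', rfl, rfl, hV'⟩ := List.map_eq_cons_iff.1 hV
      obtain ⟨y, V', rfl, rfl, hV''⟩ := List.map_eq_cons_iff.1 hV'
      obtain rfl := List.map_eq_nil_iff.1 hV''
      exact ⟨[y, x], rfl, .swap _ _ h⟩
  | refl u => exact ⟨fun V hV => ⟨V, hV, .refl _⟩, fun V hV => ⟨V, hV, .refl _⟩⟩
  | symm _ ih =>
    constructor
    · intro V hV
      obtain ⟨U, hU, h⟩ := ih.2 V hV
      exact ⟨U, hU, h.symm⟩
    · intro V hV
      obtain ⟨U, hU, h⟩ := ih.1 V hV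
      exact ⟨U, hU, h.symm⟩
  | trans _ _ ih₁ ih₂ =>
    constructor
    · intro V hV
      obtain ⟨U, hU, h⟩ := ih₂.1 V hV
      obtain ⟨T, hT, h'⟩ := ih₁.1 U hU
      exact ⟨T, hT, h'.trans h⟩
    · intro V hV
      obtain ⟨U, hU, h⟩ := ih₁.2 V hV
      obtain ⟨T, hT, h'⟩ := ih₂.2 U hU
      exact ⟨T, hT, h.trans h'⟩
  | append _ _ ih₁ ih₂ =>
    constructor
    · intro V hV
      obtain ⟨V₁, V₂, rfl, h₁, h₂⟩ := List.map_eq_append_iff.1 hV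
      obtain ⟨U₁, hU₁, h₁⟩ := ih₁.1 V₁ h₁
      obtain ⟨U₂, hU₂, h₂⟩ := ih₂.1 V₂ h₂
      exact ⟨U₁ ++ U₂, by simp [hU₁, hU₂], h₁.append h₂⟩
    · intro V hV
      obtain ⟨V₁, V₂, rfl, h₁, h₂⟩ := List.map_eq_append_iff.1 hV
      obtain ⟨U₁, hU₁, h₁⟩ := ih₁.2 V₁ h₁
      obtain ⟨U₂, hU₂, h₂⟩ := ih₂.2 V₂ h₂
      exact ⟨U₁ ++ U₂, by simp [hU₁, hU₂], h₁.append h₂⟩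

theorem TraceEquiv.cons {α : Type*} {I : α → α → Prop} (a : α) {u v : List α}
    (h : TraceEquiv I u v) : TraceEquiv I (a :: u) (a :: v) :=
  (TraceEquiv.refl [a]).append h

theorem TraceEquiv.cons_append_singleton {α : Type*} {I : α → α → Prop} {a : α} {l : List α}
    (h : ∀ b ∈ l, I a b) : TraceEquiv I (a :: l) (l ++ [a]) := by
  induction l with
  | nil => exact .refl _
  | cons b l ih =>
    have h₁ : TraceEquiv I (a :: b :: l) (b :: a :: l) :=
      (TraceEquiv.swap a b (h b (by simp))).append (.refl l)
    exact h₁.trans ((ih fun c hc => h c (by simp [hc])).cons b)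

/-- If a letter outside `p` is independent of every later letter in `p`, then the letters in `p`
can all be moved to the front. -/
theorem traceEquiv_filter_append {α : Type*} {I : α → α → Prop} (p : α → Bool) {w : List α}
    (h : w.Pairwise fun x y => p x = false → p y = true → I x y) :
    TraceEquiv I w (w.filter p ++ w.filter fun x => !p x) := by
  induction w with
  | nil => exact .refl _
  | cons a w ih =>
    rw [List.pairwise_cons] at h
    have h₁ := (ih h.2).cons a
    cases ha : p a
    · have h₂ : TraceEquiv I (a :: w.filter p) (w.filter p ++ [a]) :=
        TraceEquiv.cons_append_singleton fun b hb =>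
          h.1 b (List.mem_filter.1 hb).1 ha (List.mem_filter.1 hb).2
      simpa [ha] using h₁.trans (h₂.append (.refl (w.filter fun x => !p x)))
    · simpa [ha] using h₁

theorem TraceEquiv.flatten_map {α ι : Type*} {I : α → α → Prop} (l : List ι)
    {f g : ι → List α} (h : ∀ i, TraceEquiv I (f i) (g i)) :
    TraceEquiv I (l.map f).flatten (l.map g).flatten := by
  induction l with
  | nil => exact .refl _
  | cons i l ih => simpa using (h i).append ih

/-! ### Factorised words -/

/-- A word whose letters are labelled by `m` ordered factors, two letters being independent whenever
the later one belongs to an earlier factor. -/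
def IsFactored {α : Type*} (I : α → α → Prop) {m : ℕ} (W : List (α × Fin m)) : Prop :=
  W.Pairwise fun x y => x.2 ≤ y.2 ∨ I x.1 y.1

/-- The letters with label `i`, in order. -/
def factor {α : Type*} {m : ℕ} (i : Fin m) (W : List (α × Fin m)) : List α :=
  (W.filter fun x => x.2 = i).map Prod.fst

theorem factor_append {α : Type*} {m : ℕ} (i : Fin m) (U V : List (α × Fin m)) :
    factor i (U ++ V) = factor i U ++ factor i V := by
  simp [factor]

theorem mem_factor {α : Type*} {m : ℕ} {i : Fin m} {W : List (α × Fin m)} {a : α} :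
    a ∈ factor i W ↔ (a, i) ∈ W := by
  simp [factor]

theorem traceEquiv_flatten_filter {α : Type*} {I : α → α → Prop} {m : ℕ} {W : List (α × Fin m)}
    (hW : IsFactored I W) (l : List (Fin m)) (hl : l.Pairwise (· < ·)) :
    TraceEquiv (fun x y : α × Fin m => I x.1 y.1) (W.filter fun x => x.2 ∈ l)
      (l.map fun i => W.filter fun x => x.2 = i).flatten := by
  induction l with
  | nil => simpa using TraceEquiv.refl _
  | cons k l ih =>
    rw [List.pairwise_cons] at hl
    have h := traceEquiv_filter_append (I := fun x y : α × Fin m => I x.1 y.1)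
      (fun x => decide (x.2 = k)) (w := W.filter fun x => x.2 ∈ k :: l) (by
        refine List.Pairwise.imp_of_mem ?_ (List.Pairwise.filter _ hW)
        intro x y hx _ hxy hxk hyk
        have hx : x.2 = k ∨ x.2 ∈ l := by simpa using (List.mem_filter.1 hx).2
        have hxk : x.2 ≠ k := by simpa using hxk
        have hyk : y.2 = k := by simpa using hyk
        have := hl.1 _ (hx.resolve_left hxk)
        exact hxy.resolve_left (by rw [hyk]; exact not_le.2 this))
    have e₁ : ((W.filter fun x => x.2 ∈ k :: l).filter fun x => decide (x.2 = k)) =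
        W.filter fun x => x.2 = k := by
      rw [List.filter_filter]
      refine List.filter_congr fun x _ => ?_
      by_cases hx : x.2 = k <;> simp [hx]
    have e₂ : ((W.filter fun x => x.2 ∈ k :: l).filter fun x => !decide (x.2 = k)) =
        W.filter fun x => x.2 ∈ l := by
      rw [List.filter_filter]
      refine List.filter_congr fun x _ => ?_
      by_cases hx : x.2 = k
      · have : k ∉ l := fun hk => lt_irrefl _ (hl.1 k hk)
        simp [hx, this]
      · simp [hx]
    rw [e₁, e₂] at h
    simpa using h.trans ((TraceEquiv.refl _).append (ih hl.2))

theorem IsFactored.traceEquiv {α : Type*} {I : α → α → Prop} {m : ℕ} {W : List (α × Fin m)}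
    (hW : IsFactored I W) :
    TraceEquiv I (W.map Prod.fst) ((List.finRange m).map fun i => factor i W).flatten := by
  have h := (traceEquiv_flatten_filter hW (List.finRange m) (List.pairwise_lt_finRange m)).map
    (I := I) Prod.fst fun _ _ h => h
  simpa [List.map_flatten, Function.comp_def, factor] using h

theorem exists_isFactored {α : Type*} {I : α → α → Prop} (hI : IsIndependence I) {m : ℕ}
    (x : Fin m → List α) {w : List α}
    (h : TraceEquiv I w ((List.finRange m).map x).flatten) :
    ∃ W : List (α × Fin m), W.map Prod.fst = w ∧ IsFactored I W ∧
      ∀ i, TraceEquiv I (factor i W) (x i) := by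
  set Z : List (α × Fin m) := ((List.finRange m).map fun i => (x i).map fun a => (a, i)).flatten
    with hZ
  obtain ⟨W, hW, hWZ⟩ := (h.lift (Prod.fst : α × Fin m → α)).1 Z (by
    simp [hZ, List.map_flatten, Function.comp_def])
  refine ⟨W, hW, ?_, fun i => ?_⟩
  · refine (hWZ.pairwise_iff fun a b hab => ⟨.inr hab, .inr (hI.symm _ _ hab)⟩).2 ?_
    rw [hZ, List.pairwise_flatten]
    constructor
    · intro l hl
      obtain ⟨i, -, rfl⟩ := List.mem_map.1 hl
      rw [List.pairwise_map]
      exact List.pairwise_of_forall fun _ _ => .inl le_rfl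
    · rw [List.pairwise_map]
      refine (List.pairwise_lt_finRange m).imp fun {i j} hij a ha b hb => ?_
      obtain ⟨a, -, rfl⟩ := List.mem_map.1 ha
      obtain ⟨b, -, rfl⟩ := List.mem_map.1 hb
      exact .inl hij.le
  · have h₁ := (hWZ.filter fun y => decide (y.2 = i)).map (I := I) Prod.fst fun _ _ h => h
    have h₂ : ∀ l : List (Fin m), l.Nodup →
        (((l.map fun i => (x i).map fun a => (a, i)).flatten.filter
          fun y => decide (y.2 = i)).map Prod.fst) = if i ∈ l then x i else [] := by
      intro l hl
      induction l with
      | nil => simp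
      | cons k l ih =>
        rw [List.nodup_cons] at hl
        by_cases hk : k = i
        · subst hk
          have := ih hl.2
          simp only [hl.1, if_false] at this
          simp only [List.map_cons, List.flatten_cons, List.filter_append, List.map_append, this]
          simp [List.filter_map, Function.comp_def]
        · have hk' : i ≠ k := fun e => hk e.symm
          simp only [List.map_cons, List.flatten_cons, List.filter_append, List.map_append, ih hl.2]
          simp [List.filter_map, Function.comp_def, hk, hk']
    rw [hZ, h₂ _ (List.nodup_finRange m)] at h₁
    simpa [factor] using h₁

/-! ### Scatterings as two-colourings -/

/-- The number of maximal runs of `true` in a sequence of marks, a run that continues a mark `true`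
just before the sequence not being counted; `p` is the mark just before the sequence. -/
def rises {α : Type*} : Bool → List (α × Bool) → ℕ
  | _, [] => 0
  | p, x :: l => (if x.2 && !p then 1 else 0) + rises x.2 l

theorem rises_true_le {α : Type*} (Z : List (α × Bool)) : rises true Z ≤ rises false Z := by
  cases Z <;> simp [rises]

theorem rises_false_le {α : Type*} (Z : List (α × Bool)) : rises false Z ≤ 1 + rises true Z := by
  cases Z with
  | nil => simp [rises]
  | cons x Z => cases hx : x.2 <;> simp [rises, hx]

theorem rises_le_false {α : Type*} (p : Bool) (Z : List (α × Bool)) :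
    rises p Z ≤ rises false Z := by
  cases p
  · exact le_rfl
  · exact rises_true_le Z

theorem rises_append_le {α : Type*} (p : Bool) (Y Z : List (α × Bool)) :
    rises p (Y ++ Z) ≤ rises p Y + rises false Z := by
  induction Y generalizing p with
  | nil => simpa [rises] using rises_le_false p Z
  | cons x Y ih =>
    have := ih x.2
    simp only [List.cons_append, rises]
    omega

theorem rises_true_append {α : Type*} {Y : List (α × Bool)} (hY : ∀ x ∈ Y, x.2 = true)
    (Z : List (α × Bool)) : rises true (Y ++ Z) = rises true Z := by
  induction Y with
  | nil => rfl
  | cons x Y ih =>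
    have hx : x.2 = true := hY x (by simp)
    simpa [rises, hx] using ih fun y hy => hY y (by simp [hy])

theorem rises_append_of_false {α : Type*} {Y : List (α × Bool)} (hY : ∀ x ∈ Y, x.2 = false)
    (hne : Y ≠ []) (p : Bool) (Z : List (α × Bool)) :
    rises p (Y ++ Z) = rises false Z := by
  induction Y generalizing p with
  | nil => exact absurd rfl hne
  | cons x Y ih =>
    have hx : x.2 = false := hY x (by simp)
    rcases eq_or_ne Y [] with rfl | h
    · simp [rises, hx]
    · simpa [rises, hx] using ih (fun y hy => hY y (by simp [hy])) h false

/-- A two-colouring `Z` of the letters of `z` in which `u` and `v` are, up to trace equivalence, the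
words of the letters marked `true` and `false`, and a letter marked `true` is independent of all
earlier letters marked `false`. -/
structure IsMarking {α : Type*} (I : α → α → Prop) (Z : List (α × Bool)) (u z v : List α) :
    Prop where
  map_fst : Z.map Prod.fst = z
  indep : Z.Pairwise fun x y => x.2 = false → y.2 = true → I x.1 y.1
  left : TraceEquiv I u ((Z.filter fun x => x.2).map Prod.fst)
  right : TraceEquiv I v ((Z.filter fun x => !x.2).map Prod.fst)

theorem IsMarking.mem_left {α : Type*} {I : α → α → Prop} {Z : List (α × Bool)} {u z v : List α}
    (h : IsMarking I Z u z v) {a : α} : a ∈ u ↔ (a, true) ∈ Z := by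
  simp [h.left.perm.mem_iff]

theorem IsMarking.mem_right {α : Type*} {I : α → α → Prop} {Z : List (α × Bool)} {u z v : List α}
    (h : IsMarking I Z u z v) {a : α} : a ∈ v ↔ (a, false) ∈ Z := by
  simp [h.right.perm.mem_iff]

/-- The blocks of a two-colouring, `v₀` and the list of the pairs `(uᵢ, vᵢ)`; the last clause
is there for the induction. -/
theorem exists_blocks {α : Type*} {I : α → α → Prop} (Z : List (α × Bool))
    (hZ : Z.Pairwise fun x y => x.2 = false → y.2 = true → I x.1 y.1) :
    ∃ (v₀ : List α) (ps : List (List α × List α)),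
      Z.map Prod.fst = v₀ ++ (ps.map fun p => p.1 ++ p.2).flatten ∧
      (Z.filter fun x => x.2).map Prod.fst = (ps.map Prod.fst).flatten ∧
      (Z.filter fun x => !x.2).map Prod.fst = v₀ ++ (ps.map Prod.snd).flatten ∧
      (∀ p ∈ ps, p.1 ≠ []) ∧
      (∀ p ∈ ps, WordIndep I v₀ p.1) ∧
      ps.Pairwise (fun p q => p.2 ≠ [] ∧ WordIndep I p.2 q.1) ∧
      ps.length ≤ rises false Z ∧ (v₀ ≠ [] → ps.length ≤ rises true Z) := by
  induction Z with
  | nil => exact ⟨[], [], by simp⟩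
  | cons x Z ih =>
    rw [List.pairwise_cons] at hZ
    obtain ⟨v₀, ps, e, eu, ev, hne, h₀, hps, hlen, hlen'⟩ := ih hZ.2
    obtain ⟨a, b⟩ := x
    cases b
    · refine ⟨a :: v₀, ps, by simp [e], by simpa using eu, by simpa using ev, hne, ?_, hps,
        by simpa [rises] using hlen, fun _ => by simpa [rises] using hlen⟩
      intro p hp c hc d hd
      rcases List.mem_cons.1 hc with rfl | hc
      · have hd' : d ∈ (Z.filter fun x => x.2).map Prod.fst := by
          rw [eu]
          exact List.mem_flatten.2 ⟨p.1, List.mem_map_of_mem hp, hd⟩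
        have hd' : (d, true) ∈ Z := by simpa using hd'
        exact hZ.1 _ hd' rfl rfl
      · exact h₀ p hp c hc d hd
    · -- A letter marked `true` extends the first `u`-block if that block comes next; otherwise it
      -- starts a block of its own.
      by_cases hm : v₀ = [] ∧ ps ≠ []
      · obtain ⟨rfl, hps₀⟩ := hm
        obtain ⟨⟨p₁, p₂⟩, qs, rfl⟩ := List.exists_cons_of_ne_nil hps₀
        refine ⟨[], (a :: p₁, p₂) :: qs, by simpa using e, by simpa using eu, by simpa using ev,
          ?_, fun _ _ c hc => absurd hc (by simp), ?_, ?_, fun h => absurd rfl h⟩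
        · intro p hp
          rcases List.mem_cons.1 hp with rfl | hp
          · simp
          · exact hne p (by simp [hp])
        · rw [List.pairwise_cons] at hps ⊢
          exact hps
        · have := rises_false_le Z
          simp only [List.length_cons, rises] at hlen ⊢
          simp
          omega
      · refine ⟨[], ([a], v₀) :: ps, by simpa using e, by simpa using eu, by simpa using ev,
          ?_, fun _ _ c hc => absurd hc (by simp), ?_, ?_, fun h => absurd rfl h⟩
        · intro p hp
          rcases List.mem_cons.1 hp with rfl | hp
          · simp
          · exact hne p hp
        · rw [List.pairwise_cons]
          refine ⟨fun p hp => ⟨fun h => hm ⟨h, List.ne_nil_of_mem hp⟩, h₀ p hp⟩, hps⟩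
        · by_cases hv : v₀ = []
          · have : ps = [] := by
              by_contra h
              exact hm ⟨hv, h⟩
            simp [rises, this]
          · have := hlen' hv
            simp [rises]
            omega

theorem scatteredEquivLE_iff {α : Type*} {I : α → α → Prop} {N : ℕ} {u z v : List α} :
    ScatteredEquivLE I N u z v ↔ ∃ Z, IsMarking I Z u z v ∧ rises false Z ≤ N := by
  constructor
  · rintro ⟨u', v', hu, ⟨n, hn, us, vs, rfl, rfl, h⟩, hv⟩
    refine ⟨(vs 0).map (fun a => (a, false)) ++ ((List.finRange n).map fun i =>
      (us i).map (fun a => (a, true)) ++ (vs i.succ).map fun a => (a, false)).flatten,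
      ⟨?_, ?_, ?_, ?_⟩, le_trans ?_ hn⟩
    · rw [h.eq]
      simp [List.map_flatten, Function.comp_def, List.ofFn_eq_map]
    · rw [List.pairwise_append, List.pairwise_flatten]
      refine ⟨?_, ⟨?_, ?_⟩, ?_⟩
      · rw [List.pairwise_map]
        exact List.pairwise_of_forall fun _ _ _ h => absurd h (by simp)
      · intro l hl
        obtain ⟨i, -, rfl⟩ := List.mem_map.1 hl
        rw [List.pairwise_append, List.pairwise_map, List.pairwise_map]
        refine ⟨List.pairwise_of_forall fun _ _ h => absurd h (by simp),
          List.pairwise_of_forall fun _ _ _ h => absurd h (by simp), ?_⟩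
        intro a ha b _ hf
        obtain ⟨a, -, rfl⟩ := List.mem_map.1 ha
        exact absurd hf (by simp)
      · rw [List.pairwise_map]
        refine (List.pairwise_lt_finRange n).imp ?_
        rintro i j hij ⟨a, a'⟩ ha ⟨b, b'⟩ hb hf ht
        obtain rfl : a' = false := hf
        obtain rfl : b' = true := ht
        exact h.indep j i.succ (by simpa using hij) a (by simpa using ha) b (by simpa using hb)
      · rintro ⟨a, a'⟩ ha ⟨b, b'⟩ hb hf ht
        obtain rfl : a' = false := hf
        obtain rfl : b' = true := ht
        obtain ⟨l, hl, hb⟩ := List.mem_flatten.1 hb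
        obtain ⟨i, -, rfl⟩ := List.mem_map.1 hl
        exact h.indep i 0 (Fin.succ_pos i) a (by simpa using ha) b (by simpa using hb)
    · simpa [List.map_flatten, List.filter_flatten, Function.comp_def, List.ofFn_eq_map,
        List.filter_map] using hu
    · simpa [List.map_flatten, List.filter_flatten, Function.comp_def, List.ofFn_eq_map,
        List.filter_map, List.finRange_succ] using hv.symm
    · have h₀ : ∀ l : List α, rises false (l.map fun a => (a, false)) = 0 := by
        intro l
        induction l with
        | nil => rfl
        | cons a l ih => simpa [rises] using ih
      have h₁ : ∀ l : List α, rises false (l.map fun a => (a, true)) ≤ 1 := by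
        intro l
        refine (rises_false_le _).trans ?_
        have := rises_true_append (Y := l.map fun a => (a, true)) (by simp) []
        simp only [List.append_nil] at this
        simp [this, rises]
      refine (rises_append_le _ _ _).trans ?_
      rw [h₀, Nat.zero_add]
      have h₂ : ∀ l : List (Fin n), rises false ((l.map fun i =>
          (us i).map (fun a => (a, true)) ++ (vs i.succ).map fun a => (a, false)).flatten) ≤
          l.length := by
        intro l
        induction l with
        | nil => simp [rises]
        | cons i l ih =>
          have h₃ := rises_append_le false ((us i).map fun a => (a, true))
            ((vs i.succ).map fun a => (a, false))
          have h₄ := h₁ (us i)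
          rw [h₀] at h₃
          refine (rises_append_le _ _ _).trans ?_
          simp only [List.length_cons]
          omega
      simpa using h₂ (List.finRange n)
  · rintro ⟨Z, hZ, hN⟩
    obtain ⟨v₀, ps, e, eu, ev, hne, h₀, hps, hlen, -⟩ := exists_blocks Z hZ.indep
    have hget : ∀ {β : Type _} (f : List α × List α → β),
        (List.ofFn fun i => f (ps.get i)) = ps.map f := by
      intro β f
      rw [List.ofFn_eq_map]
      exact List.map_map.symm.trans (congrArg (List.map f) (List.map_get_finRange ps))
    refine ⟨_, _, hZ.left, ⟨ps.length, hlen.trans hN, fun i => (ps.get i).1,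
      Fin.cons v₀ fun i => (ps.get i).2, ?_, ?_, ?_, ?_, ?_, ?_⟩, hZ.right.symm⟩
    · rw [hget, eu]
    · rw [List.ofFn_succ]
      simp only [Fin.cons_zero, Fin.cons_succ, List.flatten_cons]
      rw [hget Prod.snd, ev]
    · exact fun i => hne _ (List.get_mem ps i)
    · intro j hj0 hjl
      obtain ⟨k, rfl⟩ := Fin.exists_succ_eq.2 hj0
      have hk : k.1 + 1 < ps.length := by
        have : k.1 + 1 ≠ ps.length := fun h => hjl (Fin.ext (by simpa using h))
        omega
      have := List.pairwise_iff_get.1 hps k ⟨k.1 + 1, hk⟩ (Fin.lt_def.2 (by simp))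
      simpa using this.1
    · rw [← hZ.map_fst, e]
      simp only [Fin.cons_zero, Fin.cons_succ]
      rw [hget fun p => p.1 ++ p.2]
    · intro i j hij
      induction j using Fin.cases with
      | zero => exact h₀ _ (List.get_mem ps i)
      | succ k => exact (List.pairwise_iff_get.1 hps k i (by simpa using hij)).2

/-- Markings of the factors combine to a marking of the product. -/
theorem IsMarking.flatten {α : Type*} {I : α → α → Prop} (hI : IsIndependence I) {m : ℕ}
    {U V : List (α × Fin m)} (hUV : IsFactored I (U ++ V)) {Z : Fin m → List (α × Bool)}
    {z : Fin m → List α} (hZ : ∀ i, IsMarking I (Z i) (factor i U) (z i) (factor i V)) :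
    ((List.finRange m).map Z).Pairwise
      (fun X Y => ∀ x ∈ X, ∀ y ∈ Y, x.2 = false → y.2 = true → I x.1 y.1) ∧
    IsMarking I ((List.finRange m).map Z).flatten (U.map Prod.fst)
      ((List.finRange m).map z).flatten (V.map Prod.fst) := by
  have hUV' := List.pairwise_append.1 hUV
  have hp : ((List.finRange m).map Z).Pairwise
      (fun X Y => ∀ x ∈ X, ∀ y ∈ Y, x.2 = false → y.2 = true → I x.1 y.1) := by
    rw [List.pairwise_map]
    refine (List.pairwise_lt_finRange m).imp ?_
    rintro i j hij ⟨a, a'⟩ ha ⟨b, b'⟩ hb hf ht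
    obtain rfl : a' = false := hf
    obtain rfl : b' = true := ht
    have ha := mem_factor.1 ((hZ i).mem_right.2 ha)
    have hb := mem_factor.1 ((hZ j).mem_left.2 hb)
    exact hI.symm _ _ ((hUV'.2.2 _ hb _ ha).resolve_left (not_le.2 hij))
  refine ⟨hp, ?_, ?_, ?_, ?_⟩
  · simp [List.map_flatten, Function.comp_def, (hZ _).map_fst]
  · rw [List.pairwise_flatten]
    refine ⟨fun l hl => ?_, hp⟩
    obtain ⟨i, -, rfl⟩ := List.mem_map.1 hl
    exact (hZ i).indep
  · have h : IsFactored I U := hUV'.1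
    simpa [List.map_flatten, List.filter_flatten, Function.comp_def] using
      h.traceEquiv.trans (TraceEquiv.flatten_map _ fun i => (hZ i).left)
  · have h : IsFactored I V := hUV'.2.1
    simpa [List.map_flatten, List.filter_flatten, Function.comp_def] using
      h.traceEquiv.trans (TraceEquiv.flatten_map _ fun i => (hZ i).right)

/-! ### Basic languages, sums and products -/

theorem HasUniformRankLE.mono {α : Type*} {I : α → α → Prop} {L : Language α} {M N : ℕ}
    (h : HasUniformRankLE I L M) (hMN : M ≤ N) : HasUniformRankLE I L N := by
  intro w hw
  obtain ⟨z, hz, h⟩ := h w hw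
  refine ⟨z, hz, fun u v huv => ?_⟩
  obtain ⟨u', v', hu, ⟨n, hn, r⟩, hv⟩ := h u v huv
  exact ⟨u', v', hu, ⟨n, hn.trans hMN, r⟩, hv⟩

theorem HasUniformRankLE.add {α : Type*} {I : α → α → Prop} {K L : Language α} {M N : ℕ}
    (hK : HasUniformRankLE I K M) (hL : HasUniformRankLE I L N) :
    HasUniformRankLE I (K + L) (max M N) := by
  rintro w ⟨x, hx | hx, hwx⟩
  · obtain ⟨z, hz, h⟩ := hK.mono (le_max_left M N) w ⟨x, hx, hwx⟩
    exact ⟨z, Or.inl hz, h⟩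
  · obtain ⟨z, hz, h⟩ := hL.mono (le_max_right M N) w ⟨x, hx, hwx⟩
    exact ⟨z, Or.inr hz, h⟩

theorem HasUniformRankLE.mul {α : Type*} {I : α → α → Prop} (hI : IsIndependence I)
    {K L : Language α} {M N : ℕ} (hK : HasUniformRankLE I K M) (hL : HasUniformRankLE I L N) :
    HasUniformRankLE I (K * L) (M + N) := by
  rintro w ⟨xy, hxy, hw⟩
  obtain ⟨x, hx, y, hy, rfl⟩ := Language.mem_mul.1 hxy
  obtain ⟨W, hWw, hW, hf⟩ := exists_isFactored hI ![x, y] (w := w) (by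
    simpa [List.finRange_succ] using hw)
  obtain ⟨z₀, hz₀, h₀⟩ := hK (factor 0 W) ⟨x, hx, hf 0⟩
  obtain ⟨z₁, hz₁, h₁⟩ := hL (factor 1 W) ⟨y, hy, hf 1⟩
  refine ⟨z₀ ++ z₁, Language.append_mem_mul hz₀ hz₁, fun u v huv => ?_⟩
  subst hWw
  obtain ⟨U, V, rfl, rfl, rfl⟩ := List.map_eq_append_iff.1 huv
  obtain ⟨Z₀, hZ₀, r₀⟩ := scatteredEquivLE_iff.1 (h₀ _ _ (factor_append 0 U V))
  obtain ⟨Z₁, hZ₁, r₁⟩ := scatteredEquivLE_iff.1 (h₁ _ _ (factor_append 1 U V))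
  have h := (IsMarking.flatten hI hW (Z := ![Z₀, Z₁]) (z := ![z₀, z₁])
    (Fin.forall_fin_two.2 ⟨hZ₀, hZ₁⟩)).2
  refine scatteredEquivLE_iff.2 ⟨Z₀ ++ Z₁, by simpa [List.finRange_succ] using h, ?_⟩
  exact (rises_append_le _ _ _).trans (add_le_add r₀ r₁)

theorem hasUniformRankLE_zero {α : Type*} (I : α → α → Prop) :
    HasUniformRankLE I (0 : Language α) 0 := by
  rintro w ⟨z, hz, -⟩
  exact absurd hz (Language.notMem_zero z)

theorem rises_le_length {α : Type*} (p : Bool) (Z : List (α × Bool)) :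
    rises p Z ≤ Z.length := by
  induction Z generalizing p with
  | nil => simp [rises]
  | cons x Z ih =>
    have := ih x.2
    simp only [rises, List.length_cons]
    split_ifs <;> omega

/-- A word of length at most one is the only word trace equivalent to it. -/
theorem hasUniformRankLE_singleton {α : Type*} (I : α → α → Prop) {x : List α}
    (hx : x.length ≤ 1) : HasUniformRankLE I ({x} : Set (List α)) 1 := by
  rintro w ⟨z, hz, hw⟩
  have hzx : z = x := hz
  have hwz : w = z := by
    subst hzx
    rcases z with _ | ⟨a, _ | ⟨b, z⟩⟩
    · exact List.perm_nil.1 hw.perm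
    · exact List.perm_singleton.1 hw.perm
    · simp at hx
  rw [← hzx, ← hwz] at hx
  subst hwz
  refine ⟨w, hz, ?_⟩
  rintro u v rfl
  refine scatteredEquivLE_iff.2 ⟨u.map (fun a => (a, true)) ++ v.map fun a => (a, false),
    ⟨?_, ?_, ?_, ?_⟩, (rises_le_length _ _).trans (by simpa using hx)⟩
  · simp [Function.comp_def]
  · refine List.pairwise_append.2 ⟨?_, ?_, ?_⟩
    · rw [List.pairwise_map]
      exact List.pairwise_of_forall fun _ _ h => absurd h (by simp)
    · rw [List.pairwise_map]
      exact List.pairwise_of_forall fun _ _ _ h => absurd h (by simp)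
    · intro a ha b _ hf
      obtain ⟨a, -, rfl⟩ := List.mem_map.1 ha
      exact absurd hf (by simp)
  · simpa [List.filter_map, Function.comp_def] using TraceEquiv.refl _
  · simpa [List.filter_map, Function.comp_def] using TraceEquiv.refl _

/-! ### Stars of connected languages -/

/-- In a connected word, two colours that both occur meet in a pair of dependent letters. -/
theorem WordConnected.trichotomy {α : Type*} {I : α → α → Prop} (hI : IsIndependence I)
    {Z : List (α × Bool)} (h : WordConnected I (Z.map Prod.fst)) :
    (∀ x ∈ Z, x.2 = true) ∨ (∀ x ∈ Z, x.2 = false) ∨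
      ∃ a b, (a, true) ∈ Z ∧ (b, false) ∈ Z ∧ ¬ I a b := by
  by_contra! hcon
  obtain ⟨⟨x, hx, hx'⟩, ⟨y, hy, hy'⟩, hcon⟩ := hcon
  set G := dependenceGraph I (Z.map Prod.fst)
  have hlt : ∀ i : Fin (Z.map Prod.fst).length, i.1 < Z.length := fun i => by
    simpa using i.2
  have hadj : ∀ i j, G.Adj i j → (Z[i.1]'(hlt i)).2 = (Z[j.1]'(hlt j)).2 := by
    intro i j hij
    have hdep : ¬ I (Z[i.1]'(hlt i)).1 (Z[j.1]'(hlt j)).1 ∧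
        ¬ I (Z[j.1]'(hlt j)).1 (Z[i.1]'(hlt i)).1 := by
      rcases ((SimpleGraph.fromRel_adj _ _ _).1 hij).2 with h | h
      · have h := h.2
        simp only [List.get_eq_getElem, List.getElem_map] at h
        exact ⟨h, fun h' => h (hI.symm _ _ h')⟩
      · have h := h.2
        simp only [List.get_eq_getElem, List.getElem_map] at h
        exact ⟨fun h' => h (hI.symm _ _ h'), h⟩
    have hi := List.getElem_mem (hlt i)
    have hj := List.getElem_mem (hlt j)
    generalize Z[i.1]'(hlt i) = p at *
    generalize Z[j.1]'(hlt j) = q at *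
    obtain ⟨a, a'⟩ := p
    obtain ⟨b, b'⟩ := q
    cases a' <;> cases b' <;> try rfl
    · exact absurd (hcon b a hj hi) hdep.2
    · exact absurd (hcon a b hi hj) hdep.1
  have hreach : ∀ i j, G.Reachable i j → (Z[i.1]'(hlt i)).2 = (Z[j.1]'(hlt j)).2 := by
    rintro i j ⟨p⟩
    induction p with
    | nil => rfl
    | cons hadj' _ ih => exact (hadj _ _ hadj').trans ih
  obtain ⟨i, hi, rfl⟩ := List.getElem_of_mem hx
  obtain ⟨j, hj, rfl⟩ := List.getElem_of_mem hy
  have := hreach ⟨i, by simpa using hi⟩ ⟨j, by simpa using hj⟩ (h _ _)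
  simp only at this
  rw [this] at hx'
  simp_all

/-- The bound on the number of runs in a product of marked factors. The set `A` contains the letters
that may still be marked `true`. A factor with both marks contributes at most `N` runs and, having
two dependent letters with different marks, removes a letter from `A`. Between two such factors, the
factors marked `true` throughout precede those marked `false` throughout, which gives at most one
more run. The second and third bounds, needed for the induction, say that one run is saved if a run
is already under way at the start or if the first factor is not marked `true` throughout. -/
theorem rises_flatten_le {α : Type*} {I : α → α → Prop} (hI : IsIndependence I) (N : ℕ)
    (B : List (List (α × Bool))) (A : Finset α)
    (hA : ∀ X ∈ B, ∀ a, (a, true) ∈ X → a ∈ A)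
    (hne : ∀ X ∈ B, X ≠ []) (hN : ∀ X ∈ B, rises false X ≤ N)
    (htri : ∀ X ∈ B, (∀ x ∈ X, x.2 = true) ∨ (∀ x ∈ X, x.2 = false) ∨
      ∃ a b, (a, true) ∈ X ∧ (b, false) ∈ X ∧ ¬ I a b)
    (hB : B.Pairwise fun X Y => ∀ x ∈ X, ∀ y ∈ Y, x.2 = false → y.2 = true → I x.1 y.1)
    (hchain : B.IsChain fun X Y => ¬ ((∀ x ∈ X, x.2 = false) ∧ ∀ y ∈ Y, y.2 = true)) :
    rises false B.flatten ≤ A.card * (N + 1) ∧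
    rises true B.flatten ≤ A.card * (N + 1) - 1 ∧
    ((∀ X ∈ B.head?, ¬ ∀ x ∈ X, x.2 = true) →
      rises false B.flatten ≤ A.card * (N + 1) - 1) := by
  classical
  induction B generalizing A with
  | nil => simp [rises]
  | cons X B ih =>
    rw [List.pairwise_cons] at hB
    have hchain' := List.isChain_cons.1 hchain
    have ih := fun A' hA' => ih A' hA' (fun Y hY => hne Y (by simp [hY]))
      (fun Y hY => hN Y (by simp [hY])) (fun Y hY => htri Y (by simp [hY])) hB.2 hchain'.2
    have hX := hne X (by simp)
    rw [List.flatten_cons]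
    rcases htri X (by simp) with ht | hf | ⟨a, b, ha, hb, hab⟩
    · have ih := ih A fun Y hY => hA Y (by simp [hY])
      have h₁ := rises_true_append ht B.flatten
      have h₂ := rises_false_le (X ++ B.flatten)
      have hpos : 0 < A.card * (N + 1) := by
        obtain ⟨⟨a, a'⟩, l, rfl⟩ := List.exists_cons_of_ne_nil hX
        obtain rfl : a' = true := ht (a, a') (by simp)
        have ha : a ∈ A := hA ((a, true) :: l) (by simp) a (by simp)
        exact Nat.mul_pos (Finset.card_pos.2 ⟨a, ha⟩) (Nat.succ_pos N)
      refine ⟨by omega, by omega, fun h => absurd ht (h X (by simp))⟩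
    · have ih := (ih A fun Y hY => hA Y (by simp [hY])).2.2 fun Y hY h => hchain'.1 Y hY ⟨hf, h⟩
      rw [rises_append_of_false hf hX, rises_append_of_false hf hX]
      refine ⟨by omega, by omega, fun _ => by omega⟩
    · set A' := A.erase a with hA'
      have ih := (ih A' fun Y hY c hc => Finset.mem_erase.2 ⟨?_, hA Y (by simp [hY]) c hc⟩).1
      · have hcard : A'.card + 1 = A.card :=
          Finset.card_erase_add_one (hA X (by simp) a ha)
        have h₁ := rises_append_le false X B.flatten
        have h₂ := hN X (by simp)
        have h₃ := rises_true_le (X ++ B.flatten)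
        have h₄ : A.card * (N + 1) = A'.card * (N + 1) + (N + 1) := by rw [← hcard]; ring
        refine ⟨by omega, by omega, fun _ => by omega⟩
      · rintro rfl
        exact hab (hI.symm _ _ (hB.1 Y hY _ hb _ hc rfl rfl))

theorem swap_le_swap {m : ℕ} {i j k l : Fin m} (hij : i.1 + 1 = j.1) (hkl : k ≤ l)
    (h : ¬ (k = i ∧ l = j)) : Equiv.swap i j k ≤ Equiv.swap i j l := by
  simp only [Equiv.swap_apply_def]
  simp only [Fin.ext_iff, Fin.le_def] at *
  split_ifs <;> omega

/-- The factors can be ordered so that no split of the word has a factor wholly in `V` directly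
followed by a nonempty factor wholly in `U`. The order taken is the one with the lexicographically
least word of labels: otherwise exchanging the two labels would give a smaller one. -/
theorem exists_isFactored_no_inversion {α : Type*} {I : α → α → Prop} {m : ℕ}
    (S : Set (List α)) (W₀ : List (α × Fin m)) (h₀ : IsFactored I W₀)
    (hS : ∀ i, factor i W₀ ∈ S) :
    ∃ W : List (α × Fin m), W.map Prod.fst = W₀.map Prod.fst ∧ IsFactored I W ∧
      (∀ i, factor i W ∈ S) ∧
      ∀ U V, W = U ++ V → ∀ i j : Fin m, i.1 + 1 = j.1 → factor i U = [] → factor j V = [] →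
        factor j U = [] := by
  set T : Set (List (α × Fin m)) := {W | W.map Prod.fst = W₀.map Prod.fst ∧ IsFactored I W ∧
    ∀ i, factor i W ∈ S} with hT
  have hfin : (List.map Prod.snd '' T).Finite := by
    refine (List.finite_length_eq (Fin m) W₀.length).subset ?_
    rintro _ ⟨W, hW, rfl⟩
    have := congrArg List.length hW.1
    simpa using this
  obtain ⟨_, ⟨W, hW, rfl⟩, hmin⟩ := Set.exists_min_image _ id hfin
    ⟨_, Set.mem_image_of_mem _ (show W₀ ∈ T from ⟨rfl, h₀, hS⟩)⟩
  refine ⟨W, hW.1, hW.2.1, hW.2.2, ?_⟩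
  rintro U V rfl i j hij hiU hjV
  by_contra hjU
  have hi : ∀ x ∈ U, x.2 ≠ i := fun x hx h => by
    have : x.1 ∈ factor i U := mem_factor.2 (by rw [← h]; exact hx)
    simp [hiU] at this
  have hj : ∀ x ∈ V, x.2 ≠ j := fun x hx h => by
    have : x.1 ∈ factor j V := mem_factor.2 (by rw [← h]; exact hx)
    simp [hjV] at this
  set σ := Equiv.swap i j with hσ
  have hfac : ∀ k, factor k ((U ++ V).map fun x => (x.1, σ x.2)) = factor (σ k) (U ++ V) := by
    intro k
    simp only [factor, List.filter_map, List.map_map]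
    congr 1
    refine List.filter_congr fun x _ => ?_
    simp only [Function.comp_apply, decide_eq_decide, hσ]
    exact Equiv.swap_apply_eq_iff
  have hmem : ((U ++ V).map fun x => (x.1, σ x.2)) ∈ T := by
    refine ⟨?_, ?_, fun k => ?_⟩
    · rw [← hW.1, List.map_map]
      rfl
    · -- Only a letter of factor `i` before one of factor `j` could violate the new order.
      have hnot : (U ++ V).Pairwise fun x y => ¬ (x.2 = i ∧ y.2 = j) := by
        refine List.pairwise_append.2 ⟨?_, ?_, fun x hx y _ h => hi x hx h.1⟩
        · exact List.Pairwise.imp_of_mem (R := fun _ _ => True)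
            (fun hx _ _ h => hi _ hx h.1) (List.pairwise_of_forall fun _ _ => trivial)
        · exact List.Pairwise.imp_of_mem (R := fun _ _ => True)
            (fun _ hy _ h => hj _ hy h.2) (List.pairwise_of_forall fun _ _ => trivial)
      rw [IsFactored, List.pairwise_map]
      refine (hW.2.1.and hnot).imp ?_
      rintro x y ⟨hxy, hn⟩
      refine hxy.imp_left fun hle => ?_
      exact swap_le_swap hij hle hn
    · rw [hfac]
      exact hW.2.2 _
  have hle := hmin _ (Set.mem_image_of_mem _ hmem)
  refine absurd hle (not_le.2 ?_)
  have hjmem : j ∈ U.map Prod.snd := by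
    obtain ⟨a, l, ha⟩ := List.exists_cons_of_ne_nil hjU
    exact List.mem_map.2 ⟨(a, j), mem_factor.1 (by simp [ha]), rfl⟩
  obtain ⟨l₁, l₂, hU, hjl₁⟩ := List.eq_append_cons_of_mem hjmem
  have hil₁ : ∀ k ∈ l₁, σ k = k := by
    intro k hk
    refine Equiv.swap_apply_of_ne_of_ne ?_ fun h => hjl₁ (h ▸ hk)
    have : k ∈ U.map Prod.snd := by rw [hU]; simp [hk]
    obtain ⟨x, hx, rfl⟩ := List.mem_map.1 this
    exact hi x hx
  -- The two words of labels agree up to the first `j`, where the second one has the smaller `i`.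
  have hlabels : (U ++ V).map Prod.snd = l₁ ++ j :: (l₂ ++ V.map Prod.snd) := by
    simp [hU]
  have hlabels' : ((U ++ V).map fun x => (x.1, σ x.2)).map Prod.snd =
      l₁ ++ i :: (l₂ ++ V.map Prod.snd).map σ := by
    have : ((U ++ V).map fun x => (x.1, σ x.2)).map Prod.snd = ((U ++ V).map Prod.snd).map σ := by
      simp [Function.comp_def]
    rw [this, hlabels, List.map_append, List.map_cons, List.map_congr_left hil₁]
    simp [hσ]
  simp only [id, hlabels, hlabels']
  exact List.Lex.append_left _ (List.Lex.rel (Fin.lt_def.2 (by omega))) l₁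

theorem HasUniformRankLE.kstar {α : Type*} [Fintype α] {I : α → α → Prop} (hI : IsIndependence I)
    {L : Language α} {N : ℕ} (hc : LangConnected I L) (hL : HasUniformRankLE I L N) :
    HasUniformRankLE I (KStar.kstar L) (Fintype.card α * (N + 1)) := by
  rintro w ⟨x, hx, hw⟩
  rw [Language.kstar_def_nonempty] at hx
  obtain ⟨xs, rfl, hxs⟩ := hx
  obtain ⟨W₀, hW₀w, hW₀, hf⟩ := exists_isFactored hI xs.get (w := w) (by simpa using hw)
  obtain ⟨W, hWw, hW, hWL, hinv⟩ := exists_isFactored_no_inversion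
    {y | y ∈ traceClosure I L ∧ y ≠ []} W₀ hW₀ fun i =>
      ⟨⟨xs.get i, (hxs _ (List.get_mem xs i)).1, hf i⟩, fun h => by
        have := (hf i).perm
        rw [h] at this
        exact (hxs _ (List.get_mem xs i)).2 (List.nil_perm.1 this)⟩
  choose z hzL hz using fun i => hL (factor i W) (hWL i).1
  refine ⟨((List.finRange _).map z).flatten, Language.join_mem_kstar (by simpa using hzL),
    fun u v huv => ?_⟩
  rw [← hW₀w, ← hWw] at huv
  obtain ⟨U, V, rfl, rfl, rfl⟩ := List.map_eq_append_iff.1 huv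
  choose Z hZ hr using fun i =>
    scatteredEquivLE_iff.1 (hz i _ _ (factor_append i U V))
  obtain ⟨hp, hmark⟩ := IsMarking.flatten hI hW hZ
  have hne : ∀ i, Z i ≠ [] := by
    intro i h
    have hU : factor i U = [] := List.eq_nil_iff_forall_not_mem.2 fun a ha => by
      simpa [h] using (hZ i).mem_left.1 ha
    have hV : factor i V = [] := List.eq_nil_iff_forall_not_mem.2 fun a ha => by
      simpa [h] using (hZ i).mem_right.1 ha
    exact (hWL i).2 (by rw [factor_append, hU, hV]; rfl)
  refine scatteredEquivLE_iff.2 ⟨_, hmark, ?_⟩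
  refine (rises_flatten_le hI N _ Finset.univ (fun _ _ _ _ => Finset.mem_univ _)
    (by simpa using hne) (by simpa using hr) ?_ hp ?_).1
  · intro X hX
    obtain ⟨i, -, rfl⟩ := List.mem_map.1 hX
    refine WordConnected.trichotomy hI ?_
    rw [(hZ i).map_fst]
    exact hc _ (hzL i)
  · rw [List.isChain_iff_getElem]
    intro k hk
    simp only [List.length_map, List.length_finRange] at hk
    simp only [List.getElem_map, List.getElem_finRange]
    rintro ⟨h₁, h₂⟩
    set i : Fin xs.length := ⟨k, by omega⟩
    set j : Fin xs.length := ⟨k + 1, hk⟩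
    have hiU : factor i U = [] := List.eq_nil_iff_forall_not_mem.2 fun a ha => by
      simpa using h₁ _ ((hZ i).mem_left.1 ha)
    have hjV : factor j V = [] := List.eq_nil_iff_forall_not_mem.2 fun a ha => by
      simpa using h₂ _ ((hZ j).mem_right.1 ha)
    have hjU := hinv U V rfl i j rfl hiU hjV
    exact (hWL j).2 (by rw [factor_append, hjU, hjV]; rfl)

theorem StarConnected.hasUniformRank {α : Type*} [Fintype α] {I : α → α → Prop}
    (hI : IsIndependence I) {E : RegularExpression α} (hE : StarConnected I E) :
    HasUniformRank I E.matches' := by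
  induction hE with
  | zero => exact ⟨0, hasUniformRankLE_zero I⟩
  | one => exact ⟨1, hasUniformRankLE_singleton I (x := []) (by simp)⟩
  | char a => exact ⟨1, hasUniformRankLE_singleton I (x := [a]) (by simp)⟩
  | add _ _ ihE ihF =>
    obtain ⟨M, hM⟩ := ihE
    obtain ⟨N, hN⟩ := ihF
    exact ⟨_, hM.add hN⟩
  | mul _ _ ihE ihF =>
    obtain ⟨M, hM⟩ := ihE
    obtain ⟨N, hN⟩ := ihF
    exact ⟨_, hM.mul hI hN⟩
  | star _ hc ih =>
    obtain ⟨N, hN⟩ := ih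
    exact ⟨_, hN.kstar hI hc⟩

theorem mainTheorem5 {α : Type*} [Fintype α] (I : α → α → Prop) (hI : IsIndependence I) :
    (∀ E : RegularExpression α, StarConnected I E → HasUniformRank I E.matches') ∧
    (∀ (E : RegularExpression α) (N : ℕ), LangConnected I E.matches' →
      HasUniformRankLE I E.matches' N →
        HasUniformRankLE I E.star.matches' (Fintype.card α * (N + 1))) :=
  ⟨fun _ hE => hE.hasUniformRank hI, fun _ _ hc hN => hN.kstar hI hc⟩
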